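/- For an integer $d\ge 1$ let $\omega_d$ be the volume of the unit ball in $\mathbb{R}^d$, $|\mathbb{S}^{d-1}|$ the surface area of the unit sphere, and $$K_d^{\mathrm{cl}} = \frac{d}{d+2}\,\frac{(2\pi)^2}{\omega_d^{2/d}}\,,\qquad \tilde K_d = \frac{2^{6/d}\,d^2\,(2\pi)^2}{(d+2)^{2+4/d}\,|\mathbb{S}^{d-1}|^{2/d}}\;\mathcal I_d^{-2/d}\,,$$ where $$\mathcal I_d=\inf_{f,w}\ \left(\int_0^\infty w(s)^2\,ds\right)^{d/2}\int_0^\infty\frac{(1-g(t))^2}{t^{1+d/2}}\,dt\,,\qquad g(t)=\int_0^\infty w(s)f(st)\,ds\,,$$ the infimum being over all measurable functions $f,w\ge 0$ on $(0,\infty)$ with $\int_0^\infty f(s)^2\,ds=1$ for which $\int_0^\infty w(s)^2\,ds$ and $\int_0^\infty (1-g(t))^2t^{-1-d/2}\,dt$ are finite. In dimension $d=1$, $$\frac23\le \mathcal I_1\le 0.747112\,.$$ In particular, $\tilde K_1\ge (1.456)^{-2}\,K_1^{\mathrm{cl}}$. -/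

import Mathlib

open MeasureTheory Set

noncomputable section

namespace Rumin

/-- The transform `g(t) = ∫₀^∞ w(s) f(st) ds`. For `t > 0` and `f`, `w` in `L²(0,∞)` the integrand
is integrable by the Schwarz inequality. -/
def transform (f w : ℝ → ℝ) (t : ℝ) : ℝ :=
  ∫ s in Ioi (0 : ℝ), w s * f (s * t)

/-- Admissible pairs in the variational problem in dimension `d`: `f, w ≥ 0` on `(0,∞)`,
`f` and `w` square-integrable, `∫₀^∞ f² = 1`, and `∫₀^∞ (1 - g(t))² t^(-1-d/2) dt < ∞`.
The two finiteness requirements (on `w` and on the last integral) single out the pairs for which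
both factors of the functional are finite. -/
structure Admissible (d : ℕ) (f w : ℝ → ℝ) : Prop where
  f_nonneg : ∀ s, 0 < s → 0 ≤ f s
  w_nonneg : ∀ s, 0 < s → 0 ≤ w s
  f_memLp : MemLp f 2 (volume.restrict (Ioi (0 : ℝ)))
  w_memLp : MemLp w 2 (volume.restrict (Ioi (0 : ℝ)))
  f_norm : ∫ s in Ioi (0 : ℝ), f s ^ 2 = 1
  finite : IntegrableOn
    (fun t : ℝ => (1 - transform f w t) ^ 2 / t ^ (1 + (d : ℝ) / 2)) (Ioi (0 : ℝ))

/-- The functional `(∫₀^∞ w(s)² ds)^(d/2) ∫₀^∞ (1 - g(t))² t^(-1-d/2) dt`. -/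
def functional (d : ℕ) (f w : ℝ → ℝ) : ℝ :=
  (∫ s in Ioi (0 : ℝ), w s ^ 2) ^ ((d : ℝ) / 2) *
    ∫ t in Ioi (0 : ℝ), (1 - transform f w t) ^ 2 / t ^ (1 + (d : ℝ) / 2)

/-- The constant `𝓘_d`: the infimum of the (nonnegative) functional over all admissible pairs.
Since `sInf ∅ = 0`, a positive lower bound on `𝓘_d` includes that admissible pairs exist. -/
def I (d : ℕ) : ℝ :=
  sInf {x : ℝ | ∃ f w : ℝ → ℝ, Admissible d f w ∧ x = functional d f w}

/-- The surface area `|𝕊^{d-1}|` of the unit sphere in `ℝ^d`. -/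
def sphereArea (d : ℕ) : ℝ :=
  (volume : Measure (EuclideanSpace ℝ (Fin d))).toSphere.real univ

/-- The measure `ω_d` of the unit ball in `ℝ^d`. -/
def ballVolume (d : ℕ) : ℝ :=
  (volume : Measure (EuclideanSpace ℝ (Fin d))).real (Metric.ball 0 1)

/-- The classical constant `K_d^cl = d/(d+2) · (2π)² / ω_d^(2/d)`. -/
def Kcl (d : ℕ) : ℝ :=
  (d : ℝ) / (d + 2) * ((2 * Real.pi) ^ 2 / ballVolume d ^ (2 / (d : ℝ)))

/-- The constant
`K̃_d = 2^(6/d) d² (2π)² / ((d+2)^(2+4/d) |𝕊^{d-1}|^(2/d)) · 𝓘_d^(-2/d)`. -/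
def Ktilde (d : ℕ) : ℝ :=
  (2 : ℝ) ^ (6 / (d : ℝ)) * (d : ℝ) ^ 2 * (2 * Real.pi) ^ 2 /
      (((d : ℝ) + 2) ^ (2 + 4 / (d : ℝ)) * sphereArea d ^ (2 / (d : ℝ))) *
    I d ^ (-(2 / (d : ℝ)))

end Rumin

end

namespace Rumin

/-! Lower bound: let `A = ∫ w²`. Since `∫ f(st)² ds = 1/t`, the Schwarz inequality gives `g(t) ≤
√(A/t)`, which is below 1 for `t > A`. Discarding `t ≤ A`, the second factor of the functional is at
least `∫_A^∞ (1 - √(A/t))² t^(-3/2) dt = (2/3) A^(-1/2)`, and the first factor `A^(1/2)` cancels the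
dependence on `A` (`Admissible.two_thirds_le`).

Upper bound: an explicit trial pair built from powers of `s`. Here `w` lives on `(0,1]` with `∫ w =
1`, and `f = 1` on `(0,1]`, so `g = 1` on `(0,1]` and the singular weight at 0 does no harm. For `t
> 1`, `1 - g` is a finite sum of powers, so every integral is a finite rational sum
(`one_sub_transform_trial_of_lt`, `integral_trial_le`). The bound on `K̃_1` is then arithmetic,
since `|𝕊⁰| = ω_1 = 2`. -/

lemma ballVolume_one : ballVolume 1 = 2 := by
  have h := EuclideanSpace.volume_ball (Fin 1) 0 1
  have hG : Real.Gamma (1 / 2 + 1) = √Real.pi / 2 := by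
    rw [Real.Gamma_add_one (by norm_num), Real.Gamma_one_half_eq]; ring
  have hpi : √Real.pi ≠ 0 := (Real.sqrt_pos.2 Real.pi_pos).ne'
  have h2 : √Real.pi ^ 1 / (√Real.pi / 2) = 2 := by field_simp
  simp only [Fintype.card_fin, Nat.cast_one, hG, h2] at h
  simp [ballVolume, measureReal_def, h]

lemma sphereArea_one : sphereArea 1 = 2 := by
  have h := (volume : Measure (EuclideanSpace ℝ (Fin 1))).toSphere_real_apply_univ
  have h2 := ballVolume_one
  rw [ballVolume] at h2
  rw [sphereArea, h, h2]
  simp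

lemma functional_nonneg (d : ℕ) (f w : ℝ → ℝ) : 0 ≤ functional d f w := by
  refine mul_nonneg (Real.rpow_nonneg (integral_nonneg fun _ => sq_nonneg _) _)
    (setIntegral_nonneg measurableSet_Ioi fun t ht => ?_)
  exact div_nonneg (sq_nonneg _) (Real.rpow_nonneg (le_of_lt ht) _)

lemma I_le_functional {d : ℕ} {f w : ℝ → ℝ} (h : Admissible d f w) : I d ≤ functional d f w :=
  csInf_le ⟨0, by rintro _ ⟨f, w, -, rfl⟩; exact functional_nonneg d f w⟩ ⟨f, w, h, rfl⟩

/-- The variational problem is invariant under `(f, w) ↦ (l f, w / l)`, so `f` need not be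
normalized in a trial pair. -/
lemma exists_admissible_of_trial {d : ℕ} {f w : ℝ → ℝ} (hf : ∀ s, 0 < s → 0 ≤ f s)
    (hw : ∀ s, 0 < s → 0 ≤ w s) (hf2 : MemLp f 2 (volume.restrict (Ioi (0 : ℝ))))
    (hw2 : MemLp w 2 (volume.restrict (Ioi (0 : ℝ)))) (hpos : 0 < ∫ s in Ioi (0 : ℝ), f s ^ 2)
    (hfin : IntegrableOn
      (fun t : ℝ => (1 - transform f w t) ^ 2 / t ^ (1 + (d : ℝ) / 2)) (Ioi (0 : ℝ))) :
    ∃ f' w', Admissible d f' w' ∧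
      functional d f' w' = (∫ s in Ioi (0 : ℝ), f s ^ 2) ^ ((d : ℝ) / 2) * functional d f w := by
  set A := ∫ s in Ioi (0 : ℝ), f s ^ 2 with hA
  have hsA : 0 < √A := Real.sqrt_pos.2 hpos
  have hsq : √A ^ 2 = A := Real.sq_sqrt hpos.le
  have htr : transform (fun s => (√A)⁻¹ * f s) (fun s => √A * w s) = transform f w := by
    funext t
    refine integral_congr_ae (Filter.Eventually.of_forall fun s => ?_)
    simp only
    field_simp
  have hadm : Admissible d (fun s => (√A)⁻¹ * f s) (fun s => √A * w s) :=
    { f_nonneg := fun s hs => mul_nonneg (inv_nonneg.2 hsA.le) (hf s hs)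
      w_nonneg := fun s hs => mul_nonneg hsA.le (hw s hs)
      f_memLp := hf2.const_mul _
      w_memLp := hw2.const_mul _
      f_norm := by
        simp only [mul_pow, integral_const_mul, inv_pow, hsq]
        exact inv_mul_cancel₀ hpos.ne'
      finite := by rw [htr]; exact hfin }
  refine ⟨_, _, hadm, ?_⟩
  rw [functional, functional, htr]
  simp only [mul_pow, integral_const_mul, hsq]
  rw [Real.mul_rpow hpos.le (integral_nonneg fun _ => sq_nonneg _), mul_assoc]

/-! ### The lower bound `2/3`. -/

/-- Weighted Schwarz bound on the transform. -/
lemma Admissible.transform_le {d : ℕ} {f w : ℝ → ℝ} (h : Admissible d f w) {t a : ℝ}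
    (ht : 0 < t) (ha : 0 < a) :
    transform f w t ≤ (a * (∫ s in Ioi (0 : ℝ), w s ^ 2) + (a * t)⁻¹) / 2 := by
  have hw := h.w_memLp.integrable_sq
  have hf : IntegrableOn (fun s => f s ^ 2) (Ioi (0 : ℝ)) := h.f_memLp.integrable_sq
  have hf' : IntegrableOn (fun s => f (s * t) ^ 2) (Ioi (0 : ℝ)) :=
    (integrableOn_Ioi_comp_mul_right_iff (fun s => f s ^ 2) 0 ht).2 (by simpa using hf)
  have hval : ∫ s in Ioi (0 : ℝ), f (s * t) ^ 2 = t⁻¹ := by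
    have := integral_comp_mul_right_Ioi (fun s => f s ^ 2) 0 ht
    simpa [h.f_norm] using this
  calc transform f w t
      ≤ ∫ s in Ioi (0 : ℝ), (a / 2 * w s ^ 2 + a⁻¹ / 2 * f (s * t) ^ 2) := by
        refine integral_mono_of_nonneg ?_ ((hw.const_mul _).add (hf'.const_mul _)) ?_
        · filter_upwards [ae_restrict_mem measurableSet_Ioi] with s hs
          exact mul_nonneg (h.w_nonneg s hs) (h.f_nonneg _ (mul_pos hs ht))
        · refine Filter.Eventually.of_forall fun s => ?_
          have : a / 2 * w s ^ 2 + a⁻¹ / 2 * f (s * t) ^ 2 - w s * f (s * t)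
              = (a * w s - f (s * t)) ^ 2 / (2 * a) := by field_simp; ring
          have h2 : 0 ≤ (a * w s - f (s * t)) ^ 2 / (2 * a) := by positivity
          simp only
          linarith
    _ = _ := by
        rw [integral_add (hw.const_mul _) (hf'.const_mul _), integral_const_mul,
          integral_const_mul, hval, mul_inv]
        ring

/-- Otherwise `g ≤ 0`, hence `(1 - g)² ≥ 1`, and finiteness would make a pure power integrable on
`(0,∞)`, which no power is. -/
lemma Admissible.w_norm_pos {d : ℕ} {f w : ℝ → ℝ} (h : Admissible d f w) :
    0 < ∫ s in Ioi (0 : ℝ), w s ^ 2 := by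
  refine (integral_nonneg fun _ => sq_nonneg _).lt_of_ne' fun h0 => ?_
  have hle : ∀ t, 0 < t → transform f w t ≤ 0 := fun t ht => by
    refine le_of_forall_pos_le_add fun ε hε => ?_
    -- With `∫ w² = 0` the weighted bound reduces to `(at)⁻¹/2`, which this `a` makes equal to `ε`.
    have := h.transform_le ht (a := (2 * ε * t)⁻¹) (by positivity)
    rw [h0] at this
    refine this.trans_eq ?_
    field_simp
    ring
  refine not_integrableOn_Ioi_rpow (-(1 + (d : ℝ) / 2)) ?_
  refine Integrable.mono' h.finite ?_ ?_
  · exact (measurable_id.pow_const _).aestronglyMeasurable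
  · filter_upwards [ae_restrict_mem measurableSet_Ioi] with t ht
    have ht' : 0 < t := ht
    rw [Real.rpow_neg ht'.le, Real.norm_of_nonneg (by positivity), ← one_div]
    have := hle t ht'
    gcongr
    nlinarith

lemma Admissible.two_thirds_le {f w : ℝ → ℝ} (h : Admissible 1 f w) :
    2 / 3 ≤ functional 1 f w := by
  have hfin := h.finite
  set A := ∫ s in Ioi (0 : ℝ), w s ^ 2 with hA
  have hApos : 0 < A := h.w_norm_pos
  have hsA : 0 < √A := Real.sqrt_pos.2 hApos
  have hsq : √A * √A = A := Real.mul_self_sqrt hApos.le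
  have i1 := integrableOn_Ioi_rpow_of_lt (show (-(3 / 2) : ℝ) < -1 by norm_num) hApos
  have i2 := (integrableOn_Ioi_rpow_of_lt (show (-2 : ℝ) < -1 by norm_num) hApos).const_mul (2 * √A)
  have i3 := (integrableOn_Ioi_rpow_of_lt (show (-(5 / 2) : ℝ) < -1 by norm_num) hApos).const_mul A
  have e1 : A ^ (-(3 / 2) + 1 : ℝ) = (√A)⁻¹ := by
    rw [show (-(3 / 2) + 1 : ℝ) = -(1 / 2) by norm_num, Real.rpow_neg hApos.le,
      ← Real.sqrt_eq_rpow]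
  have e2 : A ^ (-2 + 1 : ℝ) = (√A)⁻¹ * (√A)⁻¹ := by
    rw [show (-2 + 1 : ℝ) = -1 by norm_num, Real.rpow_neg_one, ← mul_inv, hsq]
  have e3 : A ^ (-(5 / 2) + 1 : ℝ) = A⁻¹ * (√A)⁻¹ := by
    rw [show (-(5 / 2) + 1 : ℝ) = -1 + -(1 / 2) by norm_num, Real.rpow_add hApos,
      Real.rpow_neg_one, Real.rpow_neg hApos.le, ← Real.sqrt_eq_rpow]
  have key : 2 / 3 * (√A)⁻¹ ≤
      ∫ t in Ioi (0 : ℝ), (1 - transform f w t) ^ 2 / t ^ (1 + ((1 : ℕ) : ℝ) / 2) := by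
    calc 2 / 3 * (√A)⁻¹
        = ∫ t in Ioi A, (t ^ (-(3 / 2) : ℝ) - 2 * √A * t ^ (-2 : ℝ) + A * t ^ (-(5 / 2) : ℝ)) := by
          rw [integral_add (f := fun t : ℝ => t ^ (-(3 / 2) : ℝ) - 2 * √A * t ^ (-2 : ℝ))
              (i1.sub i2) i3, integral_sub i1 i2, integral_const_mul, integral_const_mul, integral_Ioi_rpow_of_lt (by norm_num) hApos,
            integral_Ioi_rpow_of_lt (by norm_num) hApos,
            integral_Ioi_rpow_of_lt (by norm_num) hApos, e1, e2, e3]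
          field_simp
          ring
      _ ≤ ∫ t in Ioi A, (1 - transform f w t) ^ 2 / t ^ (1 + ((1 : ℕ) : ℝ) / 2) := by
          refine setIntegral_mono_on ((i1.sub i2).add i3)
            (hfin.mono_set (Ioi_subset_Ioi hApos.le)) measurableSet_Ioi fun t ht => ?_
          have ht0 : 0 < t := hApos.trans ht
          have hst : 0 < √t := Real.sqrt_pos.2 ht0
          have hsqt : √t * √t = t := Real.mul_self_sqrt ht0.le
          have hlt : √A ≤ √t := Real.sqrt_le_sqrt (le_of_lt ht)
          have hb : transform f w t ≤ √A / √t := by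
            -- The optimal weight: it makes the two terms equal, each being `√(A/t)`.
            refine (h.transform_le ht0 (a := (√A * √t)⁻¹) (by positivity)).trans_eq ?_
            have q1 : (√A * √t)⁻¹ * (√A * √A) = √A / √t := by field_simp
            have q2 : ((√A * √t)⁻¹ * (√t * √t))⁻¹ = √A / √t := by field_simp
            rw [hsq] at q1
            rw [hsqt] at q2
            rw [← hA, q1, q2]
            ring
          -- Squaring preserves `1 - √(A/t) ≤ 1 - g(t)` because the left side is nonnegative; this
          -- is why only `t > A` is used.
          have hb1 : √A / √t ≤ 1 := (div_le_one hst).2 hlt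
          have t1 : t ^ (-(3 / 2) : ℝ) = (t ^ (1 + ((1 : ℕ) : ℝ) / 2))⁻¹ := by
            rw [← Real.rpow_neg ht0.le]; norm_num
          have hhalf : t ^ (-(1 / 2) : ℝ) = (√t)⁻¹ := by
            rw [Real.rpow_neg ht0.le, ← Real.sqrt_eq_rpow]
          have t2 : t ^ (-2 : ℝ) = t ^ (-(3 / 2) : ℝ) * (√t)⁻¹ := by
            rw [← hhalf, ← Real.rpow_add ht0]; norm_num
          have t3 : t ^ (-(5 / 2) : ℝ) = t ^ (-(3 / 2) : ℝ) * ((√t)⁻¹ * (√t)⁻¹) := by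
            rw [← hhalf, ← Real.rpow_add ht0, ← Real.rpow_add ht0]; norm_num
          calc t ^ (-(3 / 2) : ℝ) - 2 * √A * t ^ (-2 : ℝ) + A * t ^ (-(5 / 2) : ℝ)
              = (1 - √A / √t) ^ 2 / t ^ (1 + ((1 : ℕ) : ℝ) / 2) := by
                rw [t2, t3, t1]
                nth_rewrite 2 [← hsq]
                ring
            _ ≤ _ := by gcongr
      _ ≤ _ := by
          refine setIntegral_mono_set hfin ?_ (Ioi_subset_Ioi hApos.le).eventuallyLE
          filter_upwards [ae_restrict_mem measurableSet_Ioi] with t ht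
          exact div_nonneg (sq_nonneg _) (Real.rpow_nonneg (le_of_lt ht) _)
  rw [functional, ← hA, show ((1 : ℕ) : ℝ) / 2 = 1 / 2 by norm_num, ← Real.sqrt_eq_rpow]
  rw [show ((1 : ℕ) : ℝ) / 2 = 1 / 2 by norm_num] at key
  calc (2 / 3 : ℝ) = √A * (2 / 3 * (√A)⁻¹) := by field_simp
    _ ≤ _ := by gcongr

/-! ### From `𝓘_1` to the constant `K̃_1`. -/

lemma Ktilde_one_ge (hI : 0 < I 1) (hle : I 1 ≤ 0.747112) :
    Ktilde 1 ≥ (1.456 : ℝ) ^ (-2 : ℤ) * Kcl 1 := by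
  have h1 : (I 1) ^ (-(2 / ((1 : ℕ) : ℝ))) = ((I 1) ^ 2)⁻¹ := by
    rw [Real.rpow_neg hI.le]; norm_num
  have h6 : (2 : ℝ) ^ (6 / ((1 : ℕ) : ℝ)) = 64 := by
    rw [show (6 / ((1 : ℕ) : ℝ)) = ((6 : ℕ) : ℝ) by norm_num, Real.rpow_natCast]; norm_num
  have h3 : (((1 : ℕ) : ℝ) + 2) ^ (2 + 4 / ((1 : ℕ) : ℝ)) = 729 := by
    rw [show (2 + 4 / ((1 : ℕ) : ℝ)) = ((6 : ℕ) : ℝ) by norm_num, Real.rpow_natCast]; norm_num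
  have h2 : (2 : ℝ) ^ (2 / ((1 : ℕ) : ℝ)) = 4 := by
    rw [show (2 / ((1 : ℕ) : ℝ)) = ((2 : ℕ) : ℝ) by norm_num, Real.rpow_natCast]; norm_num
  rw [Ktilde, Kcl, sphereArea_one, ballVolume_one, h1, h6, h3, h2]
  have hinv : (0.747112 ^ 2 : ℝ)⁻¹ ≤ ((I 1) ^ 2)⁻¹ := by gcongr
  have hpi : 0 < (2 * Real.pi) ^ 2 := by positivity
  calc (1.456 : ℝ) ^ (-2 : ℤ) * (((1 : ℕ) : ℝ) / (((1 : ℕ) : ℝ) + 2) * ((2 * Real.pi) ^ 2 / 4))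
      = (2 * Real.pi) ^ 2 * ((1.456 : ℝ) ^ (-2 : ℤ) / 12) := by push_cast; ring
    _ ≤ (2 * Real.pi) ^ 2 * (64 / (729 * 4) * (0.747112 ^ 2 : ℝ)⁻¹) := by
        -- What remains is equivalent to `0.747112 ≤ 1.456 · 8√3/27 ≈ 0.74722`.
        gcongr
        norm_num
    _ ≤ (2 * Real.pi) ^ 2 * (64 / (729 * 4) * ((I 1) ^ 2)⁻¹) := by gcongr
    _ = _ := by push_cast; ring

/-! ### Calculus of finite sums of real powers. -/

variable {ι : Type*} [Fintype ι]

/-- The finite sum of real powers `∑ cᵢ x ^ eᵢ`. -/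
noncomputable def powSum (c e : ι → ℝ) (x : ℝ) : ℝ := ∑ i, c i * x ^ e i

lemma measurable_powSum (c e : ι → ℝ) : Measurable (powSum c e) := by
  unfold powSum
  fun_prop

lemma powSum_sq (c e : ι → ℝ) {x : ℝ} (hx : 0 < x) :
    powSum c e x ^ 2 =
      powSum (fun p : ι × ι => c p.1 * c p.2) (fun p => e p.1 + e p.2) x := by
  simp only [powSum, Fintype.sum_prod_type, sq, Finset.sum_mul_sum, Real.rpow_add hx]
  exact Finset.sum_congr rfl fun i _ => Finset.sum_congr rfl fun j _ => by ring

lemma powSum_sq_mul_rpow (c e : ι → ℝ) (r : ℝ) {x : ℝ} (hx : 0 < x) :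
    powSum c e x ^ 2 * x ^ r =
      powSum (fun p : ι × ι => c p.1 * c p.2) (fun p => e p.1 + e p.2 + r) x := by
  rw [powSum_sq c e hx, powSum, powSum, Finset.sum_mul]
  exact Finset.sum_congr rfl fun i _ => by rw [Real.rpow_add hx _ r, mul_assoc]

lemma integrableOn_powSum_Ioi {c e : ι → ℝ} (he : ∀ i, e i < -1) :
    IntegrableOn (powSum c e) (Ioi 1) :=
  integrable_finsetSum _ fun i _ =>
    (integrableOn_Ioi_rpow_of_lt (he i) one_pos).const_mul (c i)

lemma integral_powSum_Ioi {c e : ι → ℝ} (he : ∀ i, e i < -1) :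
    ∫ x in Ioi (1 : ℝ), powSum c e x = ∑ i, c i * (-1 / (e i + 1)) := by
  unfold powSum
  rw [integral_finsetSum _ fun i _ =>
    (integrableOn_Ioi_rpow_of_lt (he i) one_pos).const_mul (c i)]
  refine Finset.sum_congr rfl fun i _ => ?_
  rw [integral_const_mul, integral_Ioi_rpow_of_lt (he i) one_pos, Real.one_rpow]

lemma integrableOn_powSum_Ioc {c e : ι → ℝ} {b : ℝ} (hb : 0 ≤ b) (he : ∀ i, -1 < e i) :
    IntegrableOn (powSum c e) (Ioc 0 b) :=
  integrable_finsetSum _ fun i _ =>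
    ((intervalIntegrable_iff_integrableOn_Ioc_of_le hb).1
      (intervalIntegral.intervalIntegrable_rpow' (he i))).const_mul (c i)

lemma integral_powSum_Ioc {c e : ι → ℝ} {b : ℝ} (hb : 0 ≤ b) (he : ∀ i, -1 < e i) :
    ∫ x in Ioc 0 b, powSum c e x = ∑ i, c i * (b ^ (e i + 1) / (e i + 1)) := by
  unfold powSum
  rw [integral_finsetSum _ fun i _ => ((intervalIntegrable_iff_integrableOn_Ioc_of_le hb).1
      (intervalIntegral.intervalIntegrable_rpow' (he i))).const_mul (c i)]
  refine Finset.sum_congr rfl fun i _ => ?_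
  have h : e i + 1 ≠ 0 := by linarith [he i]
  rw [integral_const_mul, ← intervalIntegral.integral_of_le hb, integral_rpow (Or.inl (he i)),
    Real.zero_rpow h, sub_zero]

lemma intervalIntegrable_rpow_of_pos {a b : ℝ} (ha : 0 < a) (hab : a ≤ b) (r : ℝ) :
    IntervalIntegrable (fun x : ℝ => x ^ r) volume a b :=
  intervalIntegral.intervalIntegrable_rpow (Or.inr (by
    rw [uIcc_of_le hab]; exact fun h => absurd h.1 (not_le.2 ha)))

lemma integrableOn_powSum_Ioc_of_pos (c e : ι → ℝ) {a b : ℝ} (ha : 0 < a) (hab : a ≤ b) :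
    IntegrableOn (powSum c e) (Ioc a b) :=
  integrable_finsetSum _ fun i _ =>
    ((intervalIntegrable_iff_integrableOn_Ioc_of_le hab).1
      (intervalIntegrable_rpow_of_pos ha hab (e i))).const_mul (c i)

lemma integral_powSum_Ioc_of_pos {c e : ι → ℝ} {a b : ℝ} (ha : 0 < a) (hab : a ≤ b)
    (he : ∀ i, e i ≠ -1) :
    ∫ x in Ioc a b, powSum c e x =
      ∑ i, c i * ((b ^ (e i + 1) - a ^ (e i + 1)) / (e i + 1)) := by
  unfold powSum
  rw [integral_finsetSum _ fun i _ => ((intervalIntegrable_iff_integrableOn_Ioc_of_le hab).1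
      (intervalIntegrable_rpow_of_pos ha hab (e i))).const_mul (c i)]
  refine Finset.sum_congr rfl fun i _ => ?_
  rw [integral_const_mul, ← intervalIntegral.integral_of_le hab, integral_rpow (Or.inr ⟨he i, by
    rw [uIcc_of_le hab]; exact fun h => absurd h.1 (not_le.2 ha)⟩)]

/-- Gluing integrability on `(0, 1]` and `(1, ∞)`. -/
lemma integrableOn_Ioi_zero_of_eqOn {F G H : ℝ → ℝ} (hG : IntegrableOn G (Ioc 0 1))
    (hH : IntegrableOn H (Ioi 1)) (h1 : EqOn F G (Ioc 0 1)) (h2 : EqOn F H (Ioi 1)) :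
    IntegrableOn F (Ioi 0) := by
  rw [← Ioc_union_Ioi_eq_Ioi zero_le_one]
  exact (hG.congr_fun h1.symm measurableSet_Ioc).union (hH.congr_fun h2.symm measurableSet_Ioi)

lemma integral_Ioi_zero_of_eqOn {F G H : ℝ → ℝ} (hG : IntegrableOn G (Ioc 0 1))
    (hH : IntegrableOn H (Ioi 1)) (h1 : EqOn F G (Ioc 0 1)) (h2 : EqOn F H (Ioi 1)) :
    ∫ x in Ioi (0 : ℝ), F x = (∫ x in Ioc (0 : ℝ) 1, G x) + ∫ x in Ioi (1 : ℝ), H x := by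
  rw [← Ioc_union_Ioi_eq_Ioi zero_le_one,
    setIntegral_union Ioc_disjoint_Ioi_same measurableSet_Ioi
      (hG.congr_fun h1.symm measurableSet_Ioc) (hH.congr_fun h2.symm measurableSet_Ioi),
    setIntegral_congr_fun measurableSet_Ioc h1, setIntegral_congr_fun measurableSet_Ioi h2]

/-! ### The trial pair and its norms. -/

/-- The trial function `f`, up to normalization. -/
noncomputable def trialF (s : ℝ) : ℝ :=
  if s ≤ 1 then 1 else powSum ![2, -6 / 5] ![-5 / 4, -9 / 4] s

/-- The trial function `w`, equal to `10 (1 - √s)³` on `(0, 1]`. -/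
noncomputable def trialW (s : ℝ) : ℝ :=
  if s ≤ 1 then powSum ![10, -30, 30, -10] ![0, 1 / 2, 1, 3 / 2] s else 0

lemma trialF_nonneg {s : ℝ} (_ : 0 < s) : 0 ≤ trialF s := by
  unfold trialF
  split_ifs with h
  · exact zero_le_one
  · have h1 : s ^ (-9 / 4 : ℝ) ≤ s ^ (-5 / 4 : ℝ) :=
      Real.rpow_le_rpow_of_exponent_le (not_le.1 h).le (by norm_num)
    have h2 : 0 < s ^ (-5 / 4 : ℝ) := by positivity
    simp only [powSum, Fin.sum_univ_two, Matrix.cons_val_zero, Matrix.cons_val_one]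
    linarith

lemma trialW_nonneg {s : ℝ} (hs : 0 < s) : 0 ≤ trialW s := by
  unfold trialW
  split_ifs with h
  · have hle : √s ≤ 1 := Real.sqrt_le_one.2 h
    have e1 : s ^ (1 / 2 : ℝ) = √s := (Real.sqrt_eq_rpow s).symm
    have e2 : s ^ (3 / 2 : ℝ) = s * √s := by
      rw [show (3 / 2 : ℝ) = 1 + 1 / 2 by norm_num, Real.rpow_add hs, Real.rpow_one, e1]
    have e3 : √s * √s = s := Real.mul_self_sqrt hs.le
    have : powSum ![10, -30, 30, -10] ![0, 1 / 2, 1, 3 / 2] s = 10 * (1 - √s) ^ 3 := by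
      simp only [powSum, Fin.sum_univ_four, Matrix.cons_val, e1, e2, Real.rpow_zero,
        Real.rpow_one]
      linear_combination (10 * √s - 30) * e3
    rw [this]
    have := sub_nonneg.2 hle
    positivity
  · exact le_rfl

lemma measurable_trialF : Measurable trialF :=
  Measurable.ite measurableSet_Iic measurable_const (measurable_powSum _ _)

lemma measurable_trialW : Measurable trialW :=
  Measurable.ite measurableSet_Iic (measurable_powSum _ _) measurable_const

lemma trialF_sq_eqOn_Ioc : EqOn (fun s => trialF s ^ 2) (fun _ => 1) (Ioc 0 1) :=
  fun s hs => by simp [trialF, hs.2]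

lemma trialF_sq_eqOn_Ioi : EqOn (fun s => trialF s ^ 2)
    (powSum (fun p : Fin 2 × Fin 2 => (![2, -6 / 5] : Fin 2 → ℝ) p.1 * ![2, -6 / 5] p.2)
      (fun p => ![-5 / 4, -9 / 4] p.1 + ![-5 / 4, -9 / 4] p.2)) (Ioi 1) :=
  fun s hs => by
    simp only [trialF, if_neg (not_le.2 (mem_Ioi.1 hs))]
    exact powSum_sq _ _ (one_pos.trans hs)

lemma trialF_exponents (p : Fin 2 × Fin 2) :
    (![-5 / 4, -9 / 4] : Fin 2 → ℝ) p.1 + ![-5 / 4, -9 / 4] p.2 < -1 := by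
  rcases p with ⟨i, j⟩
  fin_cases i <;> fin_cases j <;> norm_num

lemma memLp_trialF : MemLp trialF 2 (volume.restrict (Ioi (0 : ℝ))) :=
  (memLp_two_iff_integrable_sq measurable_trialF.aestronglyMeasurable).2
    (integrableOn_Ioi_zero_of_eqOn (integrableOn_const (by simp))
      (integrableOn_powSum_Ioi trialF_exponents) trialF_sq_eqOn_Ioc trialF_sq_eqOn_Ioi)

lemma integral_trialF_sq : ∫ s in Ioi (0 : ℝ), trialF s ^ 2 = 1133 / 525 := by
  rw [integral_Ioi_zero_of_eqOn (integrableOn_const (by simp))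
      (integrableOn_powSum_Ioi trialF_exponents) trialF_sq_eqOn_Ioc trialF_sq_eqOn_Ioi,
    integral_powSum_Ioi trialF_exponents]
  simp only [Fintype.sum_prod_type, Fin.sum_univ_two, Matrix.cons_val_zero, Matrix.cons_val_one]
  norm_num

lemma trialW_sq_eqOn_Ioc : EqOn (fun s => trialW s ^ 2)
    (powSum (fun p : Fin 4 × Fin 4 =>
        (![10, -30, 30, -10] : Fin 4 → ℝ) p.1 * ![10, -30, 30, -10] p.2)
      (fun p => ![0, 1 / 2, 1, 3 / 2] p.1 + ![0, 1 / 2, 1, 3 / 2] p.2)) (Ioc 0 1) :=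
  fun s hs => by
    simp only [trialW, if_pos hs.2]
    exact powSum_sq _ _ hs.1

lemma trialW_sq_eqOn_Ioi : EqOn (fun s => trialW s ^ 2) (fun _ => 0) (Ioi 1) :=
  fun s hs => by simp [trialW, if_neg (not_le.2 (mem_Ioi.1 hs))]

lemma trialW_exponents (p : Fin 4 × Fin 4) :
    -1 < (![0, 1 / 2, 1, 3 / 2] : Fin 4 → ℝ) p.1 + ![0, 1 / 2, 1, 3 / 2] p.2 := by
  rcases p with ⟨i, j⟩
  have h : ∀ i, 0 ≤ (![0, 1 / 2, 1, 3 / 2] : Fin 4 → ℝ) i := fun i => by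
    fin_cases i <;> norm_num
  linarith [h i, h j]

lemma memLp_trialW : MemLp trialW 2 (volume.restrict (Ioi (0 : ℝ))) :=
  (memLp_two_iff_integrable_sq measurable_trialW.aestronglyMeasurable).2
    (integrableOn_Ioi_zero_of_eqOn (integrableOn_powSum_Ioc zero_le_one trialW_exponents)
      integrableOn_zero trialW_sq_eqOn_Ioc trialW_sq_eqOn_Ioi)

lemma integral_trialW_sq : ∫ s in Ioi (0 : ℝ), trialW s ^ 2 = 25 / 7 := by
  rw [integral_Ioi_zero_of_eqOn (integrableOn_powSum_Ioc zero_le_one trialW_exponents)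
      integrableOn_zero trialW_sq_eqOn_Ioc trialW_sq_eqOn_Ioi,
    integral_powSum_Ioc zero_le_one trialW_exponents]
  simp only [Fintype.sum_prod_type, Fin.sum_univ_four, Matrix.cons_val, Real.one_rpow]
  norm_num

/-! ### The transform of the trial pair. -/

lemma trialW_exponents' (i : Fin 4) : -1 < (![0, 1 / 2, 1, 3 / 2] : Fin 4 → ℝ) i := by
  fin_cases i <;> norm_num

/-- On the support of `w` one has `st ≤ 1`, so `f(st) = 1` and `g(t) = ∫ w`; the factor 10 in `w`
makes this 1. -/
lemma transform_trial_of_le {t : ℝ} (ht : 0 < t) (ht1 : t ≤ 1) :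
    transform trialF trialW t = 1 := by
  have h1 : EqOn (fun s => trialW s * trialF (s * t))
      (powSum ![10, -30, 30, -10] ![0, 1 / 2, 1, 3 / 2]) (Ioc 0 1) := fun s hs => by
    have : s * t ≤ 1 := mul_le_one₀ hs.2 ht.le ht1
    simp [trialW, trialF, hs.2, this]
  have h2 : EqOn (fun s => trialW s * trialF (s * t)) (fun _ => 0) (Ioi 1) := fun s hs => by
    simp [trialW, if_neg (not_le.2 (mem_Ioi.1 hs))]
  rw [transform, integral_Ioi_zero_of_eqOn
      (integrableOn_powSum_Ioc zero_le_one trialW_exponents') integrableOn_zero h1 h2,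
    integral_powSum_Ioc zero_le_one trialW_exponents']
  simp only [Fin.sum_univ_four, Matrix.cons_val, Real.one_rpow]
  norm_num

/-- The integral over `(0,1]` splits at `s = 1/t`, where `f(st)` changes formula. The endpoint `1/t`
yields the powers `t^(-1), …, t^(-5/2)` and the endpoint 1 yields the two decay rates of `f`. -/
lemma one_sub_transform_trial_of_lt {t : ℝ} (ht : 1 < t) :
    1 - transform trialF trialW t =
      powSum ![1, -402 / 5, -268, 209, 36, 256, -768 / 5]
        ![0, -1, -3 / 2, -2, -5 / 2, -5 / 4, -9 / 4] t := by
  have ht0 : 0 < t := one_pos.trans ht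
  have hti : 0 < t⁻¹ := inv_pos.2 ht0
  have hti1 : t⁻¹ ≤ 1 := inv_le_one_of_one_le₀ ht.le
  set c : Fin 4 × Fin 2 → ℝ := fun p => (![10, -30, 30, -10] : Fin 4 → ℝ) p.1 *
    ((![2, -6 / 5] : Fin 2 → ℝ) p.2 * t ^ (![-5 / 4, -9 / 4] : Fin 2 → ℝ) p.2) with hc
  set e : Fin 4 × Fin 2 → ℝ := fun p => (![0, 1 / 2, 1, 3 / 2] : Fin 4 → ℝ) p.1 +
    (![-5 / 4, -9 / 4] : Fin 2 → ℝ) p.2 with he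
  -- Half-integers plus odd quarters are never `-1`, so no logarithm appears.
  have he1 : ∀ p, e p ≠ -1 := by
    rintro ⟨i, j⟩
    fin_cases i <;> fin_cases j <;> norm_num [he]
  have h1 : EqOn (fun s => trialW s * trialF (s * t))
      (powSum ![10, -30, 30, -10] ![0, 1 / 2, 1, 3 / 2]) (Ioc 0 t⁻¹) := fun s hs => by
    have h : s * t ≤ 1 := (le_inv_mul_iff₀' ht0).1 (by simpa using hs.2)
    simp [trialW, trialF, hs.2.trans hti1, h]
  have h2 : EqOn (fun s => trialW s * trialF (s * t)) (powSum c e) (Ioc t⁻¹ 1) := fun s hs => by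
    have hs0 : 0 < s := hti.trans hs.1
    have h : ¬ s * t ≤ 1 := not_le.2 ((inv_lt_iff_one_lt_mul₀ ht0).1 hs.1)
    simp only [trialW, trialF, if_pos hs.2, if_neg h, powSum, Fintype.sum_prod_type,
      Finset.sum_mul_sum, hc, he]
    refine Finset.sum_congr rfl fun i _ => Finset.sum_congr rfl fun j _ => ?_
    rw [Real.mul_rpow hs0.le ht0.le, Real.rpow_add hs0]
    ring
  have h3 : EqOn (fun s => trialW s * trialF (s * t)) (fun _ => 0) (Ioi 1) := fun s hs => by
    simp [trialW, if_neg (not_le.2 (mem_Ioi.1 hs))]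
  have i1 := (integrableOn_powSum_Ioc hti.le trialW_exponents'
    (c := ![10, -30, 30, -10])).congr_fun h1.symm measurableSet_Ioc
  have i2 := (integrableOn_powSum_Ioc_of_pos c e hti hti1).congr_fun h2.symm measurableSet_Ioc
  have i12 : IntegrableOn (fun s => trialW s * trialF (s * t)) (Ioc 0 1) := by
    rw [← Ioc_union_Ioc_eq_Ioc hti.le hti1]
    exact i1.union i2
  have hinv : ∀ r : ℝ, t⁻¹ ^ r = t ^ (-r) := fun r => by
    rw [Real.inv_rpow ht0.le, Real.rpow_neg ht0.le]
  have hval : transform trialF trialW t =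
      ∑ i, (![10, -30, 30, -10] : Fin 4 → ℝ) i * (t⁻¹ ^ ((![0, 1 / 2, 1, 3 / 2] : Fin 4 → ℝ) i + 1) /
        ((![0, 1 / 2, 1, 3 / 2] : Fin 4 → ℝ) i + 1)) +
      ∑ p, c p * ((1 ^ (e p + 1) - t⁻¹ ^ (e p + 1)) / (e p + 1)) := by
    rw [transform, integral_Ioi_zero_of_eqOn i12 integrableOn_zero (fun _ _ => rfl) h3,
      integral_zero, add_zero, ← Ioc_union_Ioc_eq_Ioc hti.le hti1,
      setIntegral_union (Ioc_disjoint_Ioc_of_le le_rfl) measurableSet_Ioc i1 i2,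
      setIntegral_congr_fun measurableSet_Ioc h1, setIntegral_congr_fun measurableSet_Ioc h2,
      integral_powSum_Ioc hti.le trialW_exponents', integral_powSum_Ioc_of_pos hti hti1 he1]
  have hsplit : ∀ p : Fin 4 × Fin 2,
      c p * ((1 ^ (e p + 1) - t⁻¹ ^ (e p + 1)) / (e p + 1)) =
        (![10, -30, 30, -10] : Fin 4 → ℝ) p.1 * (![2, -6 / 5] : Fin 2 → ℝ) p.2 / (e p + 1) *
          (t ^ (![-5 / 4, -9 / 4] : Fin 2 → ℝ) p.2 -
            t ^ (-((![0, 1 / 2, 1, 3 / 2] : Fin 4 → ℝ) p.1 + 1))) := fun p => by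
    have : t ^ (-((![0, 1 / 2, 1, 3 / 2] : Fin 4 → ℝ) p.1 + 1)) =
        t ^ (![-5 / 4, -9 / 4] : Fin 2 → ℝ) p.2 * t ^ (-(e p + 1)) := by
      rw [← Real.rpow_add ht0]
      congr 1
      simp only [he]
      ring
    rw [this, hinv, Real.one_rpow]
    simp only [hc]
    ring
  rw [hval]
  simp only [hsplit]
  simp only [hinv, he, Fintype.sum_prod_type, powSum, Fin.sum_univ_succ,
    Finset.univ_unique, Finset.sum_singleton, Matrix.cons_val_zero,
    Matrix.cons_val_succ, Fin.default_eq_zero, Real.rpow_zero]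
  norm_num
  ring

lemma trial_eqOn_Ioc :
    EqOn (fun t : ℝ => (1 - transform trialF trialW t) ^ 2 / t ^ (1 + ((1 : ℕ) : ℝ) / 2))
      (fun _ => 0) (Ioc 0 1) :=
  fun t ht => by simp [transform_trial_of_le ht.1 ht.2]

lemma trial_eqOn_Ioi :
    EqOn (fun t : ℝ => (1 - transform trialF trialW t) ^ 2 / t ^ (1 + ((1 : ℕ) : ℝ) / 2))
      (powSum (fun p : Fin 7 × Fin 7 =>
          (![1, -402 / 5, -268, 209, 36, 256, -768 / 5] : Fin 7 → ℝ) p.1 *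
            ![1, -402 / 5, -268, 209, 36, 256, -768 / 5] p.2)
        (fun p => ![0, -1, -3 / 2, -2, -5 / 2, -5 / 4, -9 / 4] p.1 +
          ![0, -1, -3 / 2, -2, -5 / 2, -5 / 4, -9 / 4] p.2 + -(3 / 2))) (Ioi 1) :=
  fun t ht => by
    have ht0 : 0 < t := one_pos.trans ht
    simp only
    rw [← powSum_sq_mul_rpow _ _ _ ht0, one_sub_transform_trial_of_lt ht, Real.rpow_neg ht0.le,
      div_eq_mul_inv]
    norm_num

/-- The worst term is the constant one, `1 - g → 1` at infinity, where the weight `t^(-3/2)` alone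
ensures convergence. -/
lemma trial_exponents (p : Fin 7 × Fin 7) :
    (![0, -1, -3 / 2, -2, -5 / 2, -5 / 4, -9 / 4] : Fin 7 → ℝ) p.1 +
      ![0, -1, -3 / 2, -2, -5 / 2, -5 / 4, -9 / 4] p.2 + -(3 / 2) < -1 := by
  rcases p with ⟨i, j⟩
  have h : ∀ i, (![0, -1, -3 / 2, -2, -5 / 2, -5 / 4, -9 / 4] : Fin 7 → ℝ) i ≤ 0 := fun i => by
    fin_cases i <;> norm_num
  linarith [h i, h j]

lemma integrableOn_trial : IntegrableOn
    (fun t : ℝ => (1 - transform trialF trialW t) ^ 2 / t ^ (1 + ((1 : ℕ) : ℝ) / 2)) (Ioi 0) :=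
  integrableOn_Ioi_zero_of_eqOn integrableOn_zero (integrableOn_powSum_Ioi trial_exponents)
    trial_eqOn_Ioc trial_eqOn_Ioi

lemma integral_trial_le : ∫ t in Ioi (0 : ℝ),
    (1 - transform trialF trialW t) ^ 2 / t ^ (1 + ((1 : ℕ) : ℝ) / 2) ≤ 0.26895 := by
  rw [integral_Ioi_zero_of_eqOn integrableOn_zero (integrableOn_powSum_Ioi trial_exponents)
    trial_eqOn_Ioc trial_eqOn_Ioi, integral_powSum_Ioi trial_exponents]
  simp only [Fintype.sum_prod_type, Fin.sum_univ_succ, Finset.univ_unique, Finset.sum_singleton,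
    Matrix.cons_val_zero, Matrix.cons_val_succ, Fin.default_eq_zero]
  -- The 49 terms are rational, so this is an exact comparison of rationals.
  norm_num

lemma exists_admissible_functional_le : ∃ f w, Admissible 1 f w ∧ functional 1 f w ≤ 0.747112 := by
  obtain ⟨f, w, h, hfw⟩ := exists_admissible_of_trial (d := 1) (fun s => trialF_nonneg)
    (fun s => trialW_nonneg) memLp_trialF memLp_trialW
    (by rw [integral_trialF_sq]; norm_num) integrableOn_trial
  refine ⟨f, w, h, hfw.trans_le ?_⟩
  have hJ0 : 0 ≤ ∫ t in Ioi (0 : ℝ),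
      (1 - transform trialF trialW t) ^ 2 / t ^ (1 + ((1 : ℕ) : ℝ) / 2) :=
    setIntegral_nonneg measurableSet_Ioi fun t ht =>
      div_nonneg (sq_nonneg _) (Real.rpow_nonneg (le_of_lt ht) _)
  -- A rounded-up square root; `2.7764 · 0.26895 ≈ 0.74671` stays below the target.
  have hs : ((1133 / 525 : ℝ) * (25 / 7)) ^ (((1 : ℕ) : ℝ) / 2) ≤ 2.7764 := by
    rw [Nat.cast_one, ← Real.sqrt_eq_rpow]
    exact Real.sqrt_le_iff.2 ⟨by norm_num, by norm_num⟩
  rw [functional, integral_trialF_sq, integral_trialW_sq, ← mul_assoc,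
    ← Real.mul_rpow (by norm_num) (by norm_num)]
  exact (mul_le_mul hs integral_trial_le hJ0 (by norm_num)).trans (by norm_num)

/-! ### Bounds on the infimum. -/

lemma I_one_le : I 1 ≤ 0.747112 := by
  obtain ⟨f, w, h, hle⟩ := exists_admissible_functional_le
  exact (I_le_functional h).trans hle

lemma two_thirds_le_I_one : 2 / 3 ≤ I 1 := by
  -- The trial pair shows that the set of values is nonempty, without which `sInf` would be 0.
  obtain ⟨f, w, h, -⟩ := exists_admissible_functional_le
  refine le_csInf ⟨_, f, w, h, rfl⟩ ?_
  rintro _ ⟨f, w, h, rfl⟩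
  exact h.two_thirds_le

end Rumin

theorem mainTheorem8 :
    (2 / 3 ≤ Rumin.I 1 ∧ Rumin.I 1 ≤ 0.747112) ∧
      Rumin.Ktilde 1 ≥ (1.456 : ℝ) ^ (-2 : ℤ) * Rumin.Kcl 1 :=
  ⟨⟨Rumin.two_thirds_le_I_one, Rumin.I_one_le⟩,
    Rumin.Ktilde_one_ge (by linarith [Rumin.two_thirds_le_I_one]) Rumin.I_one_le⟩
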